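/- Theorem 7. Let $X$ be a complex Banach space with open unit ball $B_X$, let $\mathbb{D}$ be the open unit disk in $\mathbb{C}$, let $k,m\in\{1,2,\dots\}$ and $p\in(0,2]$. The equation $$\frac{r^k}{1-r^k}+\frac{r^m}{1-r^m}-\frac p2=0$$ has a unique root $R_1=R^p_{k,m}$ in $(0,1)$, and the following holds. Let $f:B_X\to\mathbb{D}$ be holomorphic with homogeneous polynomial expansion $f(z)=\sum_{j=0}^\infty P_j(z)$, $z\in B_X$, where $P_j$ is a homogeneous polynomial of degree $j$ (that is, $P_j(x)=u_j(x,\dots,x)$ for a $j$-linear mapping $u_j$ on $X^j$), and put $a=|f(0)|$. Let $\mu_k,\mu_m:B_X\to B_X$ be holomorphic mappings with $\mu_k(0)=\mu_m(0)=0$ for which $z=0$ is a zero of order $k$ and of order $m$, respectively; here $z=0$ is a zero of order $n$ of $\mu$ if $D^j\mu(0)=0$ for $0\le j<n$ and $D^n\mu(0)\ne0$. Then, for every $z\in B_X$ with $\|z\|=r\le R_1$, the series below converge and $$a^p+\sum_{j=1}^\infty|P_j(\mu_k(z))|+\left(\frac1{1+a}+\frac{r^k}{1-r^k}\right)\sum_{j=1}^\infty|P_j(\mu_k(z))|^2+|f(\mu_m(z))-f(0)|\le1.$$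 If $X\neq\{0\}$, the number $R_1$ is best possible: for every $r\in(R_1,1)$ there are $f$, $\mu_k$, $\mu_m$ as above and a point $z$ with $\|z\|=r$ for which the left-hand side is greater than $1$. -/

import Mathlib

noncomputable section

namespace BohrBanach

variable {X Y : Type*} [NormedAddCommGroup X] [NormedSpace ℂ X]
  [NormedAddCommGroup Y] [NormedSpace ℂ Y]

/-- `P : X → Y` is a homogeneous polynomial of degree `n`: it is the restriction to the diagonal
of an `n`-linear mapping on `X ^ n`. For `n = 0` this says that `P` is constant. -/
def IsHomogeneousPolynomial (n : ℕ) (P : X → Y) : Prop :=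
  ∃ u : MultilinearMap ℂ (fun _ : Fin n => X) Y, ∀ x, P x = u (fun _ => x)

/-- `f` is a holomorphic function from the open unit ball of `X` to the open unit disk, with
homogeneous polynomial expansion `f z = ∑ j, P j z` on the ball. Holomorphic means complex Fréchet
differentiable on the ball; values of `f` off the ball are irrelevant. -/
structure IsHolWithExpansion (f : X → ℂ) (P : ℕ → X → ℂ) : Prop where
  holo : DifferentiableOn ℂ f (Metric.ball 0 1)
  mapsTo : Set.MapsTo f (Metric.ball 0 1) (Metric.ball 0 1)
  homogeneous : ∀ j, IsHomogeneousPolynomial j (P j)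
  hasSum : ∀ z ∈ Metric.ball (0 : X) 1, HasSum (fun j => P j z) (f z)

/-- The `j`-th derivative of `g` at `0` in the direction `v`, that is, `D ^ j g (0) (v, …, v)` for
`g` holomorphic near `0`. -/
def dirDeriv (j : ℕ) (g : X → Y) (v : X) : Y :=
  iteratedDeriv j (fun h : ℂ => g (h • v)) 0

/-- `z = 0` is a zero of order `n` of `g`: the derivatives of `g` at `0` of order less than `n`
vanish and the one of order `n` does not. Being symmetric multilinear mappings, the derivatives
vanish exactly when they vanish on the diagonal. -/
def HasZeroOfOrder (n : ℕ) (g : X → Y) : Prop :=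
  (∀ j < n, ∀ v, dirDeriv j g v = 0) ∧ ∃ v, dirDeriv n g v ≠ 0

/-- `μ` is a Schwarz mapping of the open unit ball of `X` into itself with a zero of order `n`
at `0`. -/
structure IsSchwarzMapping (n : ℕ) (μ : X → X) : Prop where
  holo : DifferentiableOn ℂ μ (Metric.ball 0 1)
  mapsTo : Set.MapsTo μ (Metric.ball 0 1) (Metric.ball 0 1)
  map_zero : μ 0 = 0
  order : HasZeroOfOrder n μ

/-- The function `Ψ₁ r = r ^ k / (1 - r ^ k) + r ^ m / (1 - r ^ m) - p / 2`. -/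
def Psi (k m : ℕ) (p r : ℝ) : ℝ :=
  r ^ k / (1 - r ^ k) + r ^ m / (1 - r ^ m) - p / 2

/-- The refined Bohr sum `G_f z`, with `a = |f 0|` and `r = ‖z‖`; the series run over the degrees
`1, 2, 3, …`. -/
def bohrSum (k : ℕ) (p : ℝ) (f : X → ℂ) (P : ℕ → X → ℂ) (μk μm : X → X) (z : X) : ℝ :=
  ‖f 0‖ ^ p + ∑' j : ℕ, ‖P (j + 1) (μk z)‖
    + (1 / (1 + ‖f 0‖) + ‖z‖ ^ k / (1 - ‖z‖ ^ k)) * ∑' j : ℕ, ‖P (j + 1) (μk z)‖ ^ 2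
    + ‖f (μm z) - f 0‖

end BohrBanach

end

/-!
The argument reduces everything to one complex variable. For a unit vector `v`, the slice
`ζ ↦ f (ζ • v)` is a power series `∑ b j ζ ^ j` bounded by `1` on the disk, with `b j = P j v` and
`‖b 0‖ = a`. Multiplication by it is a contraction of the Hardy space, that is, the lower triangular
Toeplitz matrix of the `b j` is a contraction (`re_sum_fourier_le`, `toeplitz`). Testing the matrix
on suitable vectors gives Carlson's inequalities
`‖b (2 n + 1)‖ ≤ 1 - ∑ i ≤ n, ‖b i‖ ^ 2` and
`‖b (2 n)‖ ≤ 1 - ∑ i < n, ‖b i‖ ^ 2 - ‖b n‖ ^ 2 / (1 + ‖b 0‖)` (`carlson_odd`, `carlson_even`).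
Multiplied by `ρ ^ j` and summed over `j`, they bound the first sum plus the weighted sum of squares
by `(1 - a ^ 2) ρ / (1 - ρ)` (`refined_bohr`), and hence also `‖f w - f 0‖` for `‖w‖ ≤ ρ`.

The Schwarz lemma for a zero of order `n` gives `‖μ z‖ ≤ ‖z‖ ^ n`, so the Bohr sum at `‖z‖ = r` is
at most `a ^ p + (1 - a ^ 2) (r ^ k / (1 - r ^ k) + r ^ m / (1 - r ^ m))`. Up to the root of `Psi`
the last factor is at most `p / 2`, and `a ^ p + (1 - a ^ 2) p / 2 ≤ 1` is Bernoulli's inequality.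

For sharpness take a unit vector `u`, a functional `ℓ` of norm at most one with `ℓ u = 1`, the
function `(a - ℓ) / (1 - a ℓ)`, the mappings `ℓ ^ n • u` and the point `r • u`. Even without the
squares the sum is `a ^ p + (1 - a ^ 2) (r ^ k / (1 - a r ^ k) + r ^ m / (1 - a r ^ m))`, which
equals `1` at `a = 1` and has derivative `-2 Psi r < 0` there, so it exceeds `1` for some `a < 1`.
-/

namespace BohrBanach

section

open Complex Set Metric Filter Topology
open scoped ComplexConjugate

/-! ### The Toeplitz contraction -/

lemma integral_exp_int_mul (n : ℤ) :
    ∫ θ in (0 : ℝ)..2 * Real.pi, Complex.exp (n * θ * I)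
      = if n = 0 then (2 * Real.pi : ℂ) else 0 := by
  split_ifs with h
  · simp [h]
  · have hc : (n * I : ℂ) ≠ 0 := by simp [h]
    have := integral_exp_mul_complex (a := 0) (b := 2 * Real.pi) hc
    calc _ = ∫ θ in (0 : ℝ)..2 * Real.pi, Complex.exp (n * I * θ) := by
          congr 1; ext θ; ring_nf
      _ = 0 := by
          rw [this]
          have : (n * I * ((2 * Real.pi : ℝ) : ℂ)) = n * (2 * Real.pi * I) := by push_cast; ring
          rw [this, Complex.exp_int_mul_two_pi_mul_I]
          simp

/-- `F` is a function on the open unit disk bounded by `1` in modulus, and it is the sum of the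
power series with coefficients `b` there. Continuity follows from the last field; it is recorded
because it comes for free where the structure is built. -/
structure IsBoundedPowerSeries (F : ℂ → ℂ) (b : ℕ → ℂ) : Prop where
  cont : ContinuousOn F (ball 0 1)
  bound : ∀ ζ ∈ ball (0 : ℂ) 1, ‖F ζ‖ ≤ 1
  hasSum : ∀ ζ ∈ ball (0 : ℂ) 1, HasSum (fun n => b n * ζ ^ n) (F ζ)

namespace IsBoundedPowerSeries

variable {F : ℂ → ℂ} {b : ℕ → ℂ}

lemma summable_norm (h : IsBoundedPowerSeries F b) {R : ℝ} (hR0 : 0 ≤ R) (hR : R < 1) :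
    Summable (fun n => ‖b n‖ * R ^ n) := by
  have := (h.hasSum R (by simpa [abs_of_nonneg hR0] using hR)).summable.norm
  simpa [abs_of_nonneg hR0] using this

lemma circle_mem {R : ℝ} (hR0 : 0 ≤ R) (hR : R < 1) (θ : ℝ) :
    (R * Complex.exp (θ * I) : ℂ) ∈ ball (0 : ℂ) 1 := by
  simpa [Complex.norm_exp_ofReal_mul_I, abs_of_nonneg hR0] using hR

lemma continuous_circle (h : IsBoundedPowerSeries F b) {R : ℝ} (hR0 : 0 ≤ R) (hR : R < 1) :
    Continuous (fun θ : ℝ => F (R * Complex.exp (θ * I))) :=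
  h.cont.comp_continuous (by fun_prop) (circle_mem hR0 hR)

/-- The Fourier coefficients of `F` on a circle of radius `R < 1`, arranged as a lower triangular
Toeplitz matrix. -/
lemma integral_circle (h : IsBoundedPowerSeries F b) {R : ℝ} (hR0 : 0 ≤ R) (hR : R < 1)
    (i j : ℕ) :
    ∫ θ in (0 : ℝ)..2 * Real.pi,
      F (R * Complex.exp (θ * I)) * Complex.exp (((j : ℤ) - (i : ℤ) : ℤ) * θ * I)
      = 2 * Real.pi * (if j ≤ i then b (i - j) * R ^ (i - j) else 0) := by
  have key : HasSum (fun l : ℕ => ∫ θ in (0 : ℝ)..2 * Real.pi,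
      b l * R ^ l * Complex.exp (((l : ℤ) + ((j : ℤ) - (i : ℤ)) : ℤ) * θ * I))
      (∫ θ in (0 : ℝ)..2 * Real.pi,
        F (R * Complex.exp (θ * I)) * Complex.exp (((j : ℤ) - (i : ℤ) : ℤ) * θ * I)) := by
    refine intervalIntegral.hasSum_integral_of_dominated_convergence
      (fun l _ => ‖b l‖ * R ^ l) (fun l => ?_) (fun l => ?_) ?_ ?_ ?_
    · exact Continuous.aestronglyMeasurable (by fun_prop)
    · refine Eventually.of_forall fun θ _ => le_of_eq ?_
      have : Complex.exp ((((l : ℤ) + ((j : ℤ) - (i : ℤ)) : ℤ) : ℂ) * θ * I)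
        = Complex.exp (((((l : ℤ) + ((j : ℤ) - (i : ℤ)) : ℤ) * θ : ℝ) : ℂ) * I) := by
        push_cast; rfl
      rw [norm_mul, this, Complex.norm_exp_ofReal_mul_I]
      simp [abs_of_nonneg hR0]
    · exact Eventually.of_forall fun θ _ => h.summable_norm hR0 hR
    · simp
    · refine Eventually.of_forall fun θ _ => ?_
      have := (h.hasSum _ (circle_mem hR0 hR θ)).mul_right
        (Complex.exp (((j : ℤ) - (i : ℤ) : ℤ) * θ * I))
      convert! this using 2 with l
      rw [mul_pow, ← Complex.exp_nat_mul, mul_assoc (b l), mul_assoc (b l), mul_assoc ((R : ℂ) ^ l),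
        ← Complex.exp_add]
      congr 3
      push_cast; ring
  simp_rw [intervalIntegral.integral_const_mul, integral_exp_int_mul] at key
  refine key.unique ?_
  split_ifs with hij
  · convert! hasSum_ite_eq (i - j) (2 * Real.pi * (b (i - j) * R ^ (i - j)) : ℂ) using 2 with l
    by_cases hl : l = i - j
    · subst hl
      rw [if_pos (by omega), if_pos rfl]; ring
    · rw [if_neg (by omega), if_neg hl]; ring
  · convert! (hasSum_zero (α := ℂ) (β := ℕ)) using 2 with l
    · rw [if_neg (by omega)]; ring
    · ring

end IsBoundedPowerSeries

/-- **Parseval's identity** for a trigonometric polynomial. -/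
lemma integral_norm_sq_trigPoly (N : ℕ) (c : ℕ → ℂ) :
    ∫ θ in (0 : ℝ)..2 * Real.pi, ‖∑ j ∈ Finset.range N, c j * Complex.exp (j * θ * I)‖ ^ 2
      = 2 * Real.pi * ∑ j ∈ Finset.range N, ‖c j‖ ^ 2 := by
  apply Complex.ofReal_injective
  rw [← intervalIntegral.integral_ofReal]
  have h1 : ∀ θ : ℝ, ((‖∑ j ∈ Finset.range N, c j * Complex.exp (j * θ * I)‖ ^ 2 : ℝ) : ℂ)
      = ∑ j ∈ Finset.range N, ∑ i ∈ Finset.range N,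
        c j * conj (c i) * Complex.exp (((j : ℤ) - (i : ℤ) : ℤ) * θ * I) := by
    intro θ
    push_cast
    rw [← Complex.mul_conj', map_sum, Finset.sum_mul_sum]
    refine Finset.sum_congr rfl fun j _ => Finset.sum_congr rfl fun i _ => ?_
    rw [map_mul, ← Complex.exp_conj]
    simp only [map_mul, conj_ofReal, conj_I, map_natCast]
    rw [mul_mul_mul_comm, ← Complex.exp_add]
    congr 2
    ring
  simp_rw [h1]
  rw [intervalIntegral.integral_finsetSum fun j _ =>
    Continuous.intervalIntegrable (by fun_prop) _ _]
  simp_rw [fun j => intervalIntegral.integral_finsetSum (μ := MeasureTheory.volume)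
    (a := 0) (b := 2 * Real.pi)
    (s := Finset.range N) (f := fun i (θ : ℝ) =>
      c j * conj (c i) * Complex.exp (((j : ℤ) - (i : ℤ) : ℤ) * θ * I))
    fun i _ => Continuous.intervalIntegrable (by fun_prop) _ _]
  simp_rw [intervalIntegral.integral_const_mul, integral_exp_int_mul]
  push_cast
  rw [Finset.mul_sum]
  refine Finset.sum_congr rfl fun j hj => ?_
  rw [Finset.sum_eq_single j]
  · simp [Complex.mul_conj']; ring
  · intro i _ hij
    rw [if_neg (by omega), mul_zero]
  · exact fun h => absurd hj h

/-- Multiplication by a function `G` on the circle with `‖G‖ ≤ 1` is a contraction of `L²`: the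
sesquilinear form of the matrix `t` of its Fourier coefficients is bounded by `1`. -/
lemma re_sum_fourier_le {G : ℝ → ℂ} (hG : Continuous G) (hG1 : ∀ θ, ‖G θ‖ ≤ 1) {t : ℕ → ℕ → ℂ}
    (ht : ∀ i j : ℕ, ∫ θ in (0 : ℝ)..2 * Real.pi,
      G θ * Complex.exp (((j : ℤ) - (i : ℤ) : ℤ) * θ * I) = 2 * Real.pi * t i j)
    (N : ℕ) (c d : ℕ → ℂ) :
    (∑ i ∈ Finset.range N, ∑ j ∈ Finset.range N, t i j * (c j * conj (d i))).re
      ≤ (∑ j ∈ Finset.range N, ‖c j‖ ^ 2 + ∑ i ∈ Finset.range N, ‖d i‖ ^ 2) / 2 := by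
  set φ : ℝ → ℂ := fun θ => ∑ j ∈ Finset.range N, c j * Complex.exp (j * θ * I) with hφ
  set ψ : ℝ → ℂ := fun θ => ∑ j ∈ Finset.range N, d j * Complex.exp (j * θ * I) with hψ
  have hφc : Continuous φ := by fun_prop
  have hψc : Continuous ψ := by fun_prop
  have h1 : ∀ θ : ℝ, G θ * (φ θ * conj (ψ θ))
      = ∑ i ∈ Finset.range N, ∑ j ∈ Finset.range N, c j * conj (d i) *
        (G θ * Complex.exp (((j : ℤ) - (i : ℤ) : ℤ) * θ * I)) := by
    intro θ
    rw [Finset.sum_comm]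
    simp only [hφ, hψ]
    rw [map_sum, Finset.sum_mul_sum, Finset.mul_sum]
    refine Finset.sum_congr rfl fun j _ => ?_
    rw [Finset.mul_sum]
    refine Finset.sum_congr rfl fun i _ => ?_
    rw [map_mul, ← Complex.exp_conj]
    simp only [map_mul, conj_ofReal, conj_I, map_natCast]
    rw [mul_mul_mul_comm, ← Complex.exp_add, mul_left_comm]
    congr 3
    push_cast
    ring
  have h2 : ∫ θ in (0 : ℝ)..2 * Real.pi, G θ * (φ θ * conj (ψ θ))
      = 2 * Real.pi * ∑ i ∈ Finset.range N, ∑ j ∈ Finset.range N,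
        t i j * (c j * conj (d i)) := by
    simp_rw [h1]
    rw [intervalIntegral.integral_finsetSum fun j _ =>
      Continuous.intervalIntegrable (by fun_prop) _ _]
    simp_rw [fun i => intervalIntegral.integral_finsetSum (μ := MeasureTheory.volume)
      (a := 0) (b := 2 * Real.pi)
      (s := Finset.range N) (f := fun j (θ : ℝ) => c j * conj (d i) *
        (G θ * Complex.exp (((j : ℤ) - (i : ℤ) : ℤ) * θ * I)))
      fun i _ => Continuous.intervalIntegrable (by fun_prop) _ _]
    simp_rw [intervalIntegral.integral_const_mul, ht, Finset.mul_sum]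
    refine Finset.sum_congr rfl fun i _ => Finset.sum_congr rfl fun j _ => ?_
    ring
  have hGc : Continuous fun θ => G θ * (φ θ * conj (ψ θ)) := by fun_prop
  have h3 : ∫ θ in (0 : ℝ)..2 * Real.pi, (G θ * (φ θ * conj (ψ θ))).re
      ≤ ∫ θ in (0 : ℝ)..2 * Real.pi, (‖φ θ‖ ^ 2 + ‖ψ θ‖ ^ 2) / 2 := by
    refine intervalIntegral.integral_mono_on (by positivity)
      ((Complex.continuous_re.comp hGc).intervalIntegrable _ _)
      (Continuous.intervalIntegrable (by fun_prop) _ _) fun θ _ => ?_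
    calc _ ≤ ‖G θ * (φ θ * conj (ψ θ))‖ := Complex.re_le_norm _
      _ ≤ 1 * (‖φ θ‖ * ‖ψ θ‖) := by
          rw [norm_mul, norm_mul, RCLike.norm_conj]
          gcongr
          exact hG1 θ
      _ ≤ _ := by nlinarith [sq_nonneg (‖φ θ‖ - ‖ψ θ‖)]
  have h4 : ∫ θ in (0 : ℝ)..2 * Real.pi, (G θ * (φ θ * conj (ψ θ))).re
      = (∫ θ in (0 : ℝ)..2 * Real.pi, G θ * (φ θ * conj (ψ θ))).re :=
    Complex.reCLM.intervalIntegral_comp_comm (hGc.intervalIntegrable _ _)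
  rw [h4, h2, intervalIntegral.integral_div, intervalIntegral.integral_add
    (Continuous.intervalIntegrable (by fun_prop) _ _)
    (Continuous.intervalIntegrable (by fun_prop) _ _), hφ, hψ, integral_norm_sq_trigPoly,
    integral_norm_sq_trigPoly, ← mul_add, mul_div_assoc,
    show (2 * Real.pi : ℂ) = ((2 * Real.pi : ℝ) : ℂ) by push_cast; rfl, Complex.re_ofReal_mul] at h3
  exact le_of_mul_le_mul_left h3 (by positivity)

namespace IsBoundedPowerSeries

variable {F : ℂ → ℂ} {b : ℕ → ℂ}

/-- Multiplication by `F` is a contraction of the Hardy space: the sesquilinear form of the lower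
triangular Toeplitz matrix of its coefficients is bounded by `1`. This is the limit of the same
statement on the circles of radius `R < 1`. -/
lemma toeplitz (h : IsBoundedPowerSeries F b) (N : ℕ) (c d : ℕ → ℂ) :
    (∑ i ∈ Finset.range N, ∑ j ∈ Finset.range N,
      (if j ≤ i then b (i - j) else 0) * (c j * conj (d i))).re
      ≤ (∑ j ∈ Finset.range N, ‖c j‖ ^ 2 + ∑ i ∈ Finset.range N, ‖d i‖ ^ 2) / 2 := by
  set G : ℝ → ℝ := fun R => (∑ i ∈ Finset.range N, ∑ j ∈ Finset.range N,
      (if j ≤ i then b (i - j) * (R : ℂ) ^ (i - j) else 0) * (c j * conj (d i))).re with hG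
  have hc : Continuous G := by
    refine Complex.continuous_re.comp ?_
    refine continuous_finsetSum _ fun i _ => continuous_finsetSum _ fun j _ => ?_
    split_ifs <;> fun_prop
  have h1 : Tendsto G (𝓝[<] 1) (𝓝 (G 1)) := hc.continuousAt.tendsto.mono_left nhdsWithin_le_nhds
  have h2 := le_of_tendsto h1 (b := (∑ j ∈ Finset.range N, ‖c j‖ ^ 2
      + ∑ i ∈ Finset.range N, ‖d i‖ ^ 2) / 2) (by
    filter_upwards [Ioo_mem_nhdsLT (show (0 : ℝ) < 1 by norm_num)] with R hR
    exact re_sum_fourier_le (h.continuous_circle hR.1.le hR.2)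
      (fun θ => h.bound _ (circle_mem hR.1.le hR.2 θ)) (h.integral_circle hR.1.le hR.2) N c d)
  simpa [hG] using h2

/-! ### Carlson's inequalities and the refined Bohr inequality in the disk -/

/-- The common source of Carlson's inequalities. The Toeplitz form is tested on
`e_0 + ω ∑ w (M - j) conj (b (M - j)) e_j` and `ω e_M + ∑ w i b i e_i`, where the weight `w` is `1`
below the middle index `M / 2`, the free parameter `κ` at the middle index and `0` above it. The
two supports are chosen so that the matrix entries between the two tails lie above the diagonal,
except for the entry `b 0` at the middle. -/
lemma coeff_weighted (h : IsBoundedPowerSeries F b) {M : ℕ} (hM : 1 ≤ M) (κ : ℝ) :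
    ‖b M‖ + ∑ i ∈ Finset.range (M + 1),
      (if 2 * i < M then 1 else if 2 * i = M then 2 * κ - κ ^ 2 * (1 + ‖b 0‖) else 0) * ‖b i‖ ^ 2
      ≤ 1 := by
  -- `ω` is the phase of `b M`
  obtain ⟨ω, hω1, hω⟩ : ∃ ω : ℂ, ‖ω‖ = 1 ∧ b M = ‖b M‖ * ω :=
    ⟨_, Complex.norm_exp_ofReal_mul_I (arg (b M)), (Complex.norm_mul_exp_arg_mul_I _).symm⟩
  have hωω : ω * conj ω = 1 := by rw [Complex.mul_conj', hω1]; simp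
  set w : ℕ → ℝ := fun i => if 2 * i < M then 1 else if 2 * i = M then κ else 0 with hw
  have hwM : w M = 0 := by
    simp only [hw]; rw [if_neg (by omega), if_neg (by omega)]
  set T : ℕ → ℕ → ℂ := fun i j => if j ≤ i then b (i - j) else 0 with hT
  set c₁ : ℕ → ℂ := fun j => if j = 0 then 1 else 0 with hc₁
  set c₂ : ℕ → ℂ := fun j => ω * w (M - j) * conj (b (M - j)) with hc₂
  set d₁ : ℕ → ℂ := fun i => if i = M then ω else 0 with hd₁
  set d₂ : ℕ → ℂ := fun i => w i * b i with hd₂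
  set s := Finset.range (M + 1) with hs
  have main := h.toeplitz (M + 1) (fun j => c₁ j + c₂ j) (fun i => d₁ i + d₂ i)
  rw [← hs] at main
  -- the four blocks of the sesquilinear form
  have e11 : ∑ i ∈ s, ∑ j ∈ s, T i j * (c₁ j * conj (d₁ i)) = ‖b M‖ := by
    rw [Finset.sum_eq_single M, Finset.sum_eq_single 0]
    · simp only [hT, hc₁, hd₁]
      simp only [zero_le, if_true, Nat.sub_zero, one_mul]
      rw [hω, mul_assoc, hωω, mul_one, ← hω]
    · intro j _ hj; simp [hc₁, hj]
    · intro hn; simp [hs] at hn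
    · intro i _ hi; simp [hd₁, hi]
    · intro hn; simp [hs] at hn
  have e12 : ∑ i ∈ s, ∑ j ∈ s, T i j * (c₁ j * conj (d₂ i))
      = ((∑ i ∈ s, w i * ‖b i‖ ^ 2 : ℝ) : ℂ) := by
    push_cast
    refine Finset.sum_congr rfl fun i _ => ?_
    rw [Finset.sum_eq_single 0]
    · simp only [hT, hc₁, hd₂, map_mul, conj_ofReal]
      simp only [zero_le, if_true, Nat.sub_zero, one_mul]
      rw [← Complex.mul_conj']; ring
    · intro j _ hj; simp [hc₁, hj]
    · intro hn; simp [hs] at hn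
  have e21 : ∑ i ∈ s, ∑ j ∈ s, T i j * (c₂ j * conj (d₁ i))
      = ((∑ i ∈ s, w i * ‖b i‖ ^ 2 : ℝ) : ℂ) := by
    rw [Finset.sum_eq_single M]
    · rw [← Finset.sum_range_reflect]
      push_cast
      refine Finset.sum_congr rfl fun j hj => ?_
      have hj' : j ≤ M := by simp [hs] at hj; omega
      simp only [hT, hc₂, hd₁, if_true]
      rw [if_pos (Nat.sub_le _ _), Nat.sub_sub_self hj', ← Complex.mul_conj']
      linear_combination (w j * b j * conj (b j)) * hωω
    · intro i _ hi; simp [hd₁, hi]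
    · intro hn; simp [hs] at hn
  -- the last block meets the triangular matrix only at the diagonal middle entry
  have e22 : ‖∑ i ∈ s, ∑ j ∈ s, T i j * (c₂ j * conj (d₂ i))‖
      ≤ ∑ i ∈ s, if 2 * i = M then ‖b 0‖ * κ ^ 2 * ‖b i‖ ^ 2 else 0 := by
    refine norm_sum_le_of_le _ fun i hi => ?_
    have hi' : i ≤ M := by simp [hs] at hi; omega
    by_cases h2 : 2 * i = M
    · rw [if_pos h2, Finset.sum_eq_single i]
      · have hMi : M - i = i := by omega
        have hwi : w i = κ := by
          simp only [hw]; rw [if_neg (by omega), if_pos h2]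
        simp only [hT, hc₂, hd₂, hMi, hwi, le_refl, if_true, Nat.sub_self, norm_mul, map_mul,
          RCLike.norm_conj, hω1, conj_ofReal, Complex.norm_real, Real.norm_eq_abs]
        rw [← sq_abs κ]
        apply le_of_eq; ring
      · intro j _ hj
        rcases lt_or_ge i j with hij | hij
        · simp only [hT, if_neg (not_le.mpr hij), zero_mul]
        · have : w (M - j) = 0 := by
            simp only [hw]; rw [if_neg (by omega), if_neg (by omega)]
          simp [hc₂, this]
      · exact fun hn => absurd hi hn
    · rw [if_neg h2, Finset.sum_eq_zero, norm_zero]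
      intro j _
      rcases lt_or_ge i j with hij | hij
      · simp only [hT, if_neg (not_le.mpr hij), zero_mul]
      · by_cases h3 : 2 * i < M
        · have : w (M - j) = 0 := by
            simp only [hw]; rw [if_neg (by omega), if_neg (by omega)]
          simp [hc₂, this]
        · have : w i = 0 := by
            simp only [hw]; rw [if_neg h3, if_neg h2]
          simp [hd₂, this]
  have nc : ∑ j ∈ s, ‖c₁ j + c₂ j‖ ^ 2 = 1 + ∑ i ∈ s, w i ^ 2 * ‖b i‖ ^ 2 := by
    have : ∀ j ∈ s, ‖c₁ j + c₂ j‖ ^ 2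
        = (if j = 0 then 1 else 0) + w (M - j) ^ 2 * ‖b (M - j)‖ ^ 2 := by
      intro j _
      by_cases hj : j = 0
      · subst hj; simp [hc₁, hc₂, hwM]
      · simp [hc₁, hc₂, hj, hω1, mul_pow]
    rw [Finset.sum_congr rfl this, Finset.sum_add_distrib,
      ← Finset.sum_range_reflect (fun i => w i ^ 2 * ‖b i‖ ^ 2)]
    simp [hs]
  have nd : ∑ i ∈ s, ‖d₁ i + d₂ i‖ ^ 2 = 1 + ∑ i ∈ s, w i ^ 2 * ‖b i‖ ^ 2 := by
    have : ∀ i ∈ s, ‖d₁ i + d₂ i‖ ^ 2 = (if i = M then 1 else 0) + w i ^ 2 * ‖b i‖ ^ 2 := by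
      intro i _
      by_cases hi : i = M
      · subst hi; simp [hd₁, hd₂, hwM, hω1]
      · simp [hd₁, hd₂, hi, mul_pow]
    rw [Finset.sum_congr rfl this, Finset.sum_add_distrib]
    simp [hs]
  have expand : ∑ i ∈ s, ∑ j ∈ s, (if j ≤ i then b (i - j) else 0)
        * ((c₁ j + c₂ j) * conj (d₁ i + d₂ i))
      = ∑ i ∈ s, ∑ j ∈ s, T i j * (c₁ j * conj (d₁ i))
        + ∑ i ∈ s, ∑ j ∈ s, T i j * (c₁ j * conj (d₂ i))
        + ∑ i ∈ s, ∑ j ∈ s, T i j * (c₂ j * conj (d₁ i))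
        + ∑ i ∈ s, ∑ j ∈ s, T i j * (c₂ j * conj (d₂ i)) := by
    simp_rw [← Finset.sum_add_distrib]
    refine Finset.sum_congr rfl fun i _ => Finset.sum_congr rfl fun j _ => ?_
    rw [map_add]; ring
  rw [expand, e11, e12, e21, nc, nd, Complex.add_re, Complex.add_re, Complex.add_re,
    Complex.ofReal_re, Complex.ofReal_re] at main
  have hE := (Complex.abs_re_le_norm _).trans e22
  have hE' := (abs_le.mp hE).1
  have split : ∑ i ∈ s,
      (if 2 * i < M then 1 else if 2 * i = M then 2 * κ - κ ^ 2 * (1 + ‖b 0‖) else 0) * ‖b i‖ ^ 2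
      = ∑ i ∈ s, w i * ‖b i‖ ^ 2 + ∑ i ∈ s, w i * ‖b i‖ ^ 2 - ∑ i ∈ s, w i ^ 2 * ‖b i‖ ^ 2
        - ∑ i ∈ s, if 2 * i = M then ‖b 0‖ * κ ^ 2 * ‖b i‖ ^ 2 else 0 := by
    rw [← Finset.sum_add_distrib, ← Finset.sum_sub_distrib, ← Finset.sum_sub_distrib]
    refine Finset.sum_congr rfl fun i _ => ?_
    simp only [hw]
    by_cases h2 : 2 * i = M
    · rw [if_neg (by omega), if_pos h2, if_neg (by omega), if_pos h2, if_pos h2]; ring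
    · by_cases h3 : 2 * i < M
      · simp only [if_pos h3, if_neg h2]; ring
      · simp only [if_neg h3, if_neg h2]; ring
  rw [split]
  linarith

/-- **Carlson's inequality**, odd index. -/
lemma carlson_odd (h : IsBoundedPowerSeries F b) (n : ℕ) :
    ‖b (2 * n + 1)‖ ≤ 1 - ∑ i ∈ Finset.range (n + 1), ‖b i‖ ^ 2 := by
  have := h.coeff_weighted (M := 2 * n + 1) (by omega) 0
  rw [← Finset.sum_subset (s₁ := Finset.range (n + 1))
    (Finset.range_subset_range.2 (by omega))] at this
  · rw [Finset.sum_congr rfl (g := fun i => ‖b i‖ ^ 2)] at this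
    · linarith
    · intro i hi
      rw [Finset.mem_range] at hi
      rw [if_pos (by omega), one_mul]
  · intro i _ hi
    rw [Finset.mem_range] at hi
    rw [if_neg (by omega), if_neg (by omega), zero_mul]

/-- **Carlson's inequality**, even index. -/
lemma carlson_even (h : IsBoundedPowerSeries F b) {n : ℕ} (hn : 1 ≤ n) :
    ‖b (2 * n)‖ ≤ 1 - ∑ i ∈ Finset.range n, ‖b i‖ ^ 2 - ‖b n‖ ^ 2 / (1 + ‖b 0‖) := by
  -- this weight maximizes `2 * κ - κ ^ 2 * (1 + ‖b 0‖)`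
  have := h.coeff_weighted (M := 2 * n) (by omega) (1 / (1 + ‖b 0‖))
  have hb : 0 < 1 + ‖b 0‖ := by positivity
  rw [← Finset.sum_subset (s₁ := Finset.range (n + 1))
    (Finset.range_subset_range.2 (by omega)), Finset.sum_range_succ, if_neg (by omega),
    if_pos rfl, Finset.sum_congr rfl (g := fun i => ‖b i‖ ^ 2)] at this
  · have e : (2 * (1 / (1 + ‖b 0‖)) - (1 / (1 + ‖b 0‖)) ^ 2 * (1 + ‖b 0‖)) * ‖b n‖ ^ 2
        = ‖b n‖ ^ 2 / (1 + ‖b 0‖) := by field_simp; ring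
    rw [e] at this
    linarith
  · intro i hi
    rw [Finset.mem_range] at hi
    rw [if_pos (by omega), one_mul]
  · intro i _ hi
    rw [Finset.mem_range] at hi
    rw [if_neg (by omega), if_neg (by omega), zero_mul]

/-- The refined Bohr inequality for partial sums; the last term is the part of the geometric
series of `1 - ‖b 0‖ ^ 2` that is still unused after `2 * n` steps. -/
lemma refined_partial (h : IsBoundedPowerSeries F b) {ρ : ℝ} (h0 : 0 ≤ ρ) (h1 : ρ < 1) (n : ℕ) :
    ∑ j ∈ Finset.range (2 * n), ‖b (j + 1)‖ * ρ ^ (j + 1)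
      + (1 / (1 + ‖b 0‖) + ρ / (1 - ρ))
        * ∑ i ∈ Finset.range n, (‖b (i + 1)‖ * ρ ^ (i + 1)) ^ 2
      + (1 - ∑ i ∈ Finset.range (n + 1), ‖b i‖ ^ 2) * (ρ ^ (2 * n + 1) / (1 - ρ))
      ≤ (1 - ‖b 0‖ ^ 2) * (ρ / (1 - ρ)) := by
  have hρ : 0 < 1 - ρ := by linarith
  induction n with
  | zero => simp
  | succ n ih =>
    refine le_trans ?_ ih
    have odd := mul_le_mul_of_nonneg_right (h.carlson_odd n) (pow_nonneg h0 (2 * n + 1))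
    have even := mul_le_mul_of_nonneg_right (h.carlson_even (n := n + 1) (by omega))
      (pow_nonneg h0 (2 * n + 2))
    rw [show 2 * (n + 1) = 2 * n + 1 + 1 by ring, Finset.sum_range_succ, Finset.sum_range_succ,
      Finset.sum_range_succ (n := n), Finset.sum_range_succ (n := n + 1)]
    rw [show 2 * (n + 1) = 2 * n + 1 + 1 by ring] at even
    set S := ∑ i ∈ Finset.range (n + 1), ‖b i‖ ^ 2
    set Q := ∑ i ∈ Finset.range n, (‖b (i + 1)‖ * ρ ^ (i + 1)) ^ 2
    set y := ‖b (n + 1)‖ ^ 2 with hy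
    have e1 : (‖b (n + 1)‖ * ρ ^ (n + 1)) ^ 2 = y * ρ ^ (2 * n + 2) := by
      rw [hy, mul_pow, ← pow_mul]; ring_nf
    have key : (1 / (1 + ‖b 0‖) + ρ / (1 - ρ)) * (y * ρ ^ (2 * n + 2))
        + (1 - (S + y)) * (ρ ^ (2 * n + 1 + 1 + 1) / (1 - ρ))
        = (1 - S) * (ρ ^ (2 * n + 1) / (1 - ρ)) - (1 - S) * ρ ^ (2 * n + 1)
          - (1 - S - y / (1 + ‖b 0‖)) * ρ ^ (2 * n + 2) := by
      have hb : (1 + ‖b 0‖) ≠ 0 := by positivity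
      field_simp
      ring
    rw [e1, mul_add]
    linarith

lemma summable_norm_succ (h : IsBoundedPowerSeries F b) {ρ : ℝ} (h0 : 0 ≤ ρ) (h1 : ρ < 1) :
    Summable (fun j => ‖b (j + 1)‖ * ρ ^ (j + 1)) :=
  (summable_nat_add_iff 1).2 (h.summable_norm h0 h1)

lemma summable_norm_sq_succ (h : IsBoundedPowerSeries F b) {ρ : ℝ} (h0 : 0 ≤ ρ) (h1 : ρ < 1) :
    Summable (fun j => (‖b (j + 1)‖ * ρ ^ (j + 1)) ^ 2) := by
  have hs := h.summable_norm_succ h0 h1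
  have hnn : ∀ j, 0 ≤ ‖b (j + 1)‖ * ρ ^ (j + 1) := fun j => by positivity
  refine Summable.of_norm_bounded_eventually_nat hs ?_
  filter_upwards [hs.tendsto_atTop_zero.eventually (gt_mem_nhds one_pos)] with j hj
  rw [Real.norm_of_nonneg (sq_nonneg _), sq]
  exact mul_le_of_le_one_left (hnn j) hj.le

/-- The refined Bohr inequality in one variable. -/
lemma refined_bohr (h : IsBoundedPowerSeries F b) {ρ : ℝ} (h0 : 0 ≤ ρ) (h1 : ρ < 1) :
    ∑' j : ℕ, ‖b (j + 1)‖ * ρ ^ (j + 1)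
      + (1 / (1 + ‖b 0‖) + ρ / (1 - ρ)) * ∑' j : ℕ, (‖b (j + 1)‖ * ρ ^ (j + 1)) ^ 2
      ≤ (1 - ‖b 0‖ ^ 2) * (ρ / (1 - ρ)) := by
  have hρ : 0 < 1 - ρ := by linarith
  have l1 := (h.summable_norm_succ h0 h1).hasSum.tendsto_sum_nat.comp
    (tendsto_id.const_mul_atTop' (show 0 < 2 by norm_num))
  have l2 := ((h.summable_norm_sq_succ h0 h1).hasSum.tendsto_sum_nat).const_mul
    (1 / (1 + ‖b 0‖) + ρ / (1 - ρ))
  refine le_of_tendsto (l1.add l2) (Eventually.of_forall fun n => ?_)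
  have hp := h.refined_partial h0 h1 n
  have hS : 0 ≤ (1 - ∑ i ∈ Finset.range (n + 1), ‖b i‖ ^ 2) * (ρ ^ (2 * n + 1) / (1 - ρ)) :=
    mul_nonneg ((norm_nonneg _).trans (h.carlson_odd n)) (by positivity)
  simp only [Function.comp_apply, id]
  linarith

end IsBoundedPowerSeries

/-! ### The inequality in the unit ball of a Banach space -/

section Upper

variable {X : Type*} [NormedAddCommGroup X] [NormedSpace ℂ X]

/-- A holomorphic self-map of the unit ball with a zero of order `n` at `0` is bounded by the
`n`-th power of the norm. -/
lemma IsSchwarzMapping.norm_le_pow [CompleteSpace X] {n : ℕ} (hn : 1 ≤ n) {μ : X → X}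
    (h : IsSchwarzMapping n μ) {z : X} (hz : ‖z‖ < 1) : ‖μ z‖ ≤ ‖z‖ ^ n := by
  obtain ⟨k, rfl⟩ : ∃ k, n = k + 1 := ⟨n - 1, by omega⟩
  rcases eq_or_ne z 0 with rfl | hz0
  · simp [h.map_zero]
  have hzn : ‖z‖ ≠ 0 := norm_ne_zero_iff.2 hz0
  set v : X := ((‖z‖ : ℂ)⁻¹) • z with hv
  have hv1 : ‖v‖ = 1 := by simp [hv, norm_smul, hzn]
  set g : ℂ → X := fun ζ => μ (ζ • v) with hg
  have hmaps : MapsTo (fun ζ : ℂ => ζ • v) (ball 0 1) (ball 0 1) := by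
    intro ζ hζ
    simpa [norm_smul, hv1] using hζ
  have hd : DifferentiableOn ℂ g (ball 0 1) := h.holo.comp (by fun_prop) hmaps
  have hg0 : g 0 = 0 := by simp [hg, h.map_zero]
  have hmt : MapsTo g (ball 0 1) (closedBall (g 0) 1) := by
    rw [hg0]
    exact fun ζ hζ => ball_subset_closedBall (h.mapsTo (hmaps hζ))
  have hA : AnalyticAt ℂ g 0 := hd.analyticAt (ball_mem_nhds _ one_pos)
  obtain ⟨q, hq, he⟩ := (natCast_le_analyticOrderAt hA).1
    ((natCast_le_analyticOrderAt_iff_iteratedDeriv_eq_zero hA).2 fun i hi => h.order.1 i hi v)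
  have ho : (g · - g 0) =o[𝓝 0] (fun w : ℂ => ‖w - 0‖ ^ k) := by
    have h1 : (g · - g 0) =ᶠ[𝓝 0] fun ζ => ζ ^ (k + 1) • q ζ := by
      filter_upwards [he] with ζ hζ
      simpa [hg0] using hζ
    have h2 : (fun ζ : ℂ => ζ ^ (k + 1) • q ζ) =O[𝓝 0] fun ζ => ζ ^ (k + 1) • (1 : ℂ) :=
      (Asymptotics.isBigO_refl _ _).smul (hq.continuousAt.isBigO_one ℂ)
    simp only [smul_eq_mul, mul_one] at h2
    have h3 := (Asymptotics.isLittleO_pow_pow (𝕜 := ℂ) (Nat.lt_succ_self k))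
    simpa using (h1.trans_isBigO h2).trans_isLittleO h3.norm_right
  have := Complex.dist_le_mul_div_pow_of_mapsTo_ball_of_isLittleO hd hmt ho
    (z := (‖z‖ : ℂ)) (by simpa using hz)
  simpa [hg0, hg, hv, smul_smul, hzn, h.map_zero] using this

lemma IsHomogeneousPolynomial.map_smul {Y : Type*} [NormedAddCommGroup Y] [NormedSpace ℂ Y]
    {n : ℕ} {P : X → Y} (h : IsHomogeneousPolynomial n P) (c : ℂ) (x : X) :
    P (c • x) = c ^ n • P x := by
  obtain ⟨u, hu⟩ := h
  rw [hu, hu]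
  simpa using u.map_smul_univ (fun _ => c) (fun _ => x)

namespace IsHolWithExpansion

variable {f : X → ℂ} {P : ℕ → X → ℂ}

lemma coeff_zero (h : IsHolWithExpansion f P) (x : X) : P 0 x = f 0 := by
  have h0 := h.hasSum 0 (mem_ball_self one_pos)
  have h1 : HasSum (fun j => P j 0) (P 0 0) := hasSum_single 0 fun j hj => by
    have := (h.homogeneous j).map_smul 0 (0 : X)
    simpa [hj] using this
  have h2 := (h.homogeneous 0).map_smul 0 x
  rw [h0.unique h1]
  simpa using h2.symm

/-- The restriction of `f` to a complex line through `0`. -/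
lemma slice (h : IsHolWithExpansion f P) {v : X} (hv : ‖v‖ ≤ 1) :
    IsBoundedPowerSeries (fun ζ => f (ζ • v)) (fun j => P j v) := by
  have hmaps : MapsTo (fun ζ : ℂ => ζ • v) (ball 0 1) (ball 0 1) := by
    intro ζ hζ
    simp only [mem_ball_zero_iff, norm_smul] at hζ ⊢
    exact (mul_le_of_le_one_right (norm_nonneg _) hv).trans_lt hζ
  refine ⟨h.holo.continuousOn.comp (by fun_prop) hmaps, fun ζ hζ => ?_, fun ζ hζ => ?_⟩
  · exact (mem_ball_zero_iff.1 (h.mapsTo (hmaps hζ))).le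
  · convert! h.hasSum _ (hmaps hζ) using 2 with j
    rw [(h.homogeneous j).map_smul, smul_eq_mul, mul_comm]

/-- Every point `w` of the ball lies on a slice, along which the terms of the expansion are
dominated by the terms of a bounded power series at a radius `ρ ≥ ‖w‖`. -/
lemma exists_slice (h : IsHolWithExpansion f P) {w : X} {ρ : ℝ} (hw : ‖w‖ ≤ ρ) :
    ∃ F b, IsBoundedPowerSeries F b ∧ b 0 = f 0 ∧
      ∀ j, ‖P (j + 1) w‖ ≤ ‖b (j + 1)‖ * ρ ^ (j + 1) := by
  -- for `w = 0` this is `0`, and the slice is constant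
  set v : X := ((‖w‖ : ℂ)⁻¹) • w with hv
  have hv1 : ‖v‖ ≤ 1 := by
    rw [hv, norm_smul, norm_inv, Complex.norm_real, norm_norm]
    exact inv_mul_le_one
  have hwv : w = (‖w‖ : ℂ) • v := by
    rcases eq_or_ne w 0 with rfl | hw0
    · simp
    · simp [hv, smul_smul, hw0]
  refine ⟨_, _, h.slice hv1, h.coeff_zero v, fun j => ?_⟩
  rw [hwv, (h.homogeneous (j + 1)).map_smul, smul_eq_mul, norm_mul, norm_pow, Complex.norm_real,
    norm_norm, mul_comm]
  gcongr

lemma norm_map_zero_lt_one (h : IsHolWithExpansion f P) : ‖f 0‖ < 1 :=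
  mem_ball_zero_iff.1 (h.mapsTo (mem_ball_self one_pos))

/-- The refined Bohr inequality at a point `w`, with the radius `ρ` free to exceed `‖w‖`. -/
lemma refined_bohr (h : IsHolWithExpansion f P) {w : X} {ρ : ℝ} (hw : ‖w‖ ≤ ρ) (hρ : ρ < 1) :
    Summable (fun j => ‖P (j + 1) w‖) ∧ Summable (fun j => ‖P (j + 1) w‖ ^ 2) ∧
      ∑' j : ℕ, ‖P (j + 1) w‖
        + (1 / (1 + ‖f 0‖) + ρ / (1 - ρ)) * ∑' j : ℕ, ‖P (j + 1) w‖ ^ 2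
        ≤ (1 - ‖f 0‖ ^ 2) * (ρ / (1 - ρ)) := by
  obtain ⟨F, b, hb, hb0, hle⟩ := h.exists_slice hw
  have hρ0 : 0 ≤ ρ := (norm_nonneg w).trans hw
  have hρ1 : 0 < 1 - ρ := by linarith
  have hle2 : ∀ j, ‖P (j + 1) w‖ ^ 2 ≤ (‖b (j + 1)‖ * ρ ^ (j + 1)) ^ 2 := fun j =>
    pow_le_pow_left₀ (norm_nonneg _) (hle j) 2
  have s1' := hb.summable_norm_succ hρ0 hρ
  have s2' := hb.summable_norm_sq_succ hρ0 hρ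
  have s1 := Summable.of_nonneg_of_le (fun _ => norm_nonneg _) hle s1'
  have s2 := Summable.of_nonneg_of_le (fun _ => sq_nonneg _) hle2 s2'
  refine ⟨s1, s2, ?_⟩
  have hfin := hb.refined_bohr hρ0 hρ
  rw [hb0] at hfin
  refine le_trans ?_ hfin
  gcongr ?_ + _ * ?_
  · exact s1.tsum_le_tsum hle s1'
  · exact s2.tsum_le_tsum hle2 s2'

/-- The difference is dominated by the first sum of the refined inequality. -/
lemma norm_sub_le (h : IsHolWithExpansion f P) {w : X} {ρ : ℝ} (hw : ‖w‖ ≤ ρ) (hρ : ρ < 1) :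
    ‖f w - f 0‖ ≤ (1 - ‖f 0‖ ^ 2) * (ρ / (1 - ρ)) := by
  obtain ⟨s1, -, hle⟩ := h.refined_bohr hw hρ
  have hρ0 : 0 ≤ ρ := (norm_nonneg w).trans hw
  have hρ1 : 0 < 1 - ρ := by linarith
  have h1 : HasSum (fun j => P (j + 1) w) (f w - f 0) := by
    have := (hasSum_nat_add_iff' 1).2 (h.hasSum w (mem_ball_zero_iff.2 (hw.trans_lt hρ)))
    simpa [h.coeff_zero w] using this
  have h2 : 0 ≤ (1 / (1 + ‖f 0‖) + ρ / (1 - ρ)) * ∑' j : ℕ, ‖P (j + 1) w‖ ^ 2 :=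
    mul_nonneg (by positivity) (tsum_nonneg fun j => sq_nonneg _)
  calc ‖f w - f 0‖ ≤ ∑' j : ℕ, ‖P (j + 1) w‖ := h1.tsum_eq ▸ norm_tsum_le_tsum_norm s1
    _ ≤ _ := by linarith

end IsHolWithExpansion

/-- Bernoulli's inequality in the variable `a ^ 2`, with exponent `p / 2 ≤ 1`. -/
lemma rpow_add_le_one {a p : ℝ} (ha : 0 ≤ a) (hp0 : 0 < p) (hp2 : p ≤ 2) :
    a ^ p + (1 - a ^ 2) * (p / 2) ≤ 1 := by
  have h := rpow_one_add_le_one_add_mul_self (s := a ^ 2 - 1) (p := p / 2)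
    (by nlinarith [sq_nonneg a]) (by positivity) (by linarith)
  have e : (1 + (a ^ 2 - 1)) ^ (p / 2) = a ^ p := by
    rw [add_sub_cancel, ← Real.rpow_natCast, ← Real.rpow_mul ha]
    congr 1; push_cast; ring
  rw [e] at h
  linarith

/-- The refined Bohr sum is at most `1` at every point of the ball whose norm `r` satisfies
`Psi k m p r ≤ 0`. -/
lemma bohrSum_le_one [CompleteSpace X] {k m : ℕ} (hk : 1 ≤ k) (hm : 1 ≤ m) {p : ℝ} (hp0 : 0 < p)
    (hp2 : p ≤ 2) {f : X → ℂ} {P : ℕ → X → ℂ} {μk μm : X → X} (hf : IsHolWithExpansion f P)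
    (hμk : IsSchwarzMapping k μk) (hμm : IsSchwarzMapping m μm) {z : X} (hz : ‖z‖ < 1)
    (hΨ : Psi k m p ‖z‖ ≤ 0) :
    Summable (fun j : ℕ => ‖P (j + 1) (μk z)‖) ∧
      Summable (fun j : ℕ => ‖P (j + 1) (μk z)‖ ^ 2) ∧ bohrSum k p f P μk μm z ≤ 1 := by
  have hr : ∀ {n : ℕ}, 1 ≤ n → ‖z‖ ^ n < 1 := fun hn =>
    pow_lt_one₀ (norm_nonneg z) hz (by omega)
  obtain ⟨s1, s2, h1⟩ := hf.refined_bohr (hμk.norm_le_pow hk hz) (hr hk)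
  have h2 := hf.norm_sub_le (hμm.norm_le_pow hm hz) (hr hm)
  refine ⟨s1, s2, ?_⟩
  have h3 := rpow_add_le_one (norm_nonneg (f 0)) hp0 hp2
  have h4 : 0 ≤ 1 - ‖f 0‖ ^ 2 := by
    nlinarith [hf.norm_map_zero_lt_one, norm_nonneg (f 0)]
  have h5 := mul_le_mul_of_nonneg_left hΨ h4
  unfold Psi at h5
  unfold bohrSum
  linarith

end Upper

/-! ### The root -/

lemma strictMonoOn_div_one_sub : StrictMonoOn (fun x : ℝ => x / (1 - x)) (Iio 1) := by
  intro x hx y hy hxy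
  simp only [mem_Iio] at hx hy
  show x / (1 - x) < y / (1 - y)
  rw [div_lt_div_iff₀ (by linarith) (by linarith)]
  linarith

lemma Psi_strictMonoOn {k m : ℕ} (hk : 1 ≤ k) (hm : 1 ≤ m) (p : ℝ) :
    StrictMonoOn (Psi k m p) (Ico 0 1) := by
  have key : ∀ {n : ℕ}, 1 ≤ n → StrictMonoOn (fun r : ℝ => r ^ n / (1 - r ^ n)) (Ico 0 1) := by
    intro n hn r hr s hs hrs
    exact strictMonoOn_div_one_sub (pow_lt_one₀ hr.1 hr.2 (by omega))
      (pow_lt_one₀ hs.1 hs.2 (by omega)) (pow_lt_pow_left₀ hrs hr.1 (by omega))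
  intro r hr s hs hrs
  have h1 := key hk hr hs hrs
  have h2 := key hm hr hs hrs
  simp only [Psi] at h1 h2 ⊢
  linarith

lemma exists_Psi_eq_zero {k m : ℕ} (hk : 1 ≤ k) (hm : 1 ≤ m) {p : ℝ} (hp0 : 0 < p) (hp2 : p ≤ 2) :
    ∃ R ∈ Ioo (0 : ℝ) 1, Psi k m p R = 0 := by
  -- at `s ^ k = 1 / 2` the first summand of `Psi` is already `1 ≥ p / 2`
  obtain ⟨s, hs0, hsk⟩ : ∃ s : ℝ, 0 ≤ s ∧ s ^ k = 1 / 2 :=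
    ⟨(1 / 2 : ℝ) ^ ((k : ℝ)⁻¹), by positivity, Real.rpow_inv_natCast_pow (by norm_num) (by omega)⟩
  have hs1 : s < 1 := by
    by_contra hcon
    have := one_le_pow₀ (n := k) (not_lt.1 hcon)
    linarith
  have hpow : ∀ {n : ℕ}, 1 ≤ n → ∀ {r : ℝ}, 0 ≤ r → r ≤ s → r ^ n < 1 := fun hn r h0 h1 =>
    pow_lt_one₀ h0 (h1.trans_lt hs1) (by omega)
  have hcont : ContinuousOn (Psi k m p) (Icc 0 s) := by
    unfold Psi
    refine ((ContinuousOn.div (by fun_prop) (by fun_prop) ?_).add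
      (ContinuousOn.div (by fun_prop) (by fun_prop) ?_)).sub continuousOn_const
    · intro r hr; linarith [hpow hk hr.1 hr.2]
    · intro r hr; linarith [hpow hm hr.1 hr.2]
  have h0 : Psi k m p 0 < 0 := by
    simp only [Psi, zero_pow (show k ≠ 0 by omega), zero_pow (show m ≠ 0 by omega)]
    simp [hp0]
  have h1 : 0 ≤ Psi k m p s := by
    have : 0 ≤ s ^ m / (1 - s ^ m) :=
      div_nonneg (by positivity) (by linarith [hpow hm hs0 le_rfl])
    simp only [Psi, hsk]
    norm_num
    linarith
  obtain ⟨R, hR, hR0⟩ := intermediate_value_Icc hs0 hcont ⟨h0.le, h1⟩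
  refine ⟨R, ⟨lt_of_le_of_ne hR.1 ?_, hR.2.trans_lt hs1⟩, hR0⟩
  rintro rfl
  exact h0.ne hR0

/-! ### Sharpness -/

/-- As `a → 1`, the quotient `(1 - a ^ p) / (1 - a)` tends to `p`, while the second summand divided
by `1 - a` tends to `p + 2 * Psi k m p r`. -/
lemma exists_lt_of_Psi_pos {k m : ℕ} (hk : 1 ≤ k) (hm : 1 ≤ m) {p r : ℝ} (hr0 : 0 ≤ r)
    (hr1 : r < 1) (hΨ : 0 < Psi k m p r) :
    ∃ a ∈ Ioo (0 : ℝ) 1,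
      1 < a ^ p + (1 - a ^ 2) * (r ^ k / (1 - a * r ^ k) + r ^ m / (1 - a * r ^ m)) := by
  have hK : r ^ k < 1 := pow_lt_one₀ hr0 hr1 (by omega)
  have hM : r ^ m < 1 := pow_lt_one₀ hr0 hr1 (by omega)
  have h1 : Tendsto (slope (fun x : ℝ => x ^ p) 1) (𝓝[<] 1) (𝓝 p) := by
    have := (Real.hasDerivAt_rpow_const (x := 1) (p := p) (Or.inl one_ne_zero))
    rw [hasDerivAt_iff_tendsto_slope] at this
    simpa using this.mono_left (nhdsLT_le_nhdsNE 1)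
  have h2 : Tendsto (fun a : ℝ => (1 + a) * (r ^ k / (1 - a * r ^ k) + r ^ m / (1 - a * r ^ m)))
      (𝓝[<] 1) (𝓝 ((1 + 1) * (r ^ k / (1 - 1 * r ^ k) + r ^ m / (1 - 1 * r ^ m)))) := by
    refine Tendsto.mono_left ?_ nhdsWithin_le_nhds
    refine ContinuousAt.tendsto (x := (1 : ℝ)) (f := fun a : ℝ =>
      (1 + a) * (r ^ k / (1 - a * r ^ k) + r ^ m / (1 - a * r ^ m))) ?_
    have hK' : 1 - 1 * r ^ k ≠ 0 := by linarith
    have hM' : 1 - 1 * r ^ m ≠ 0 := by linarith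
    fun_prop (disch := assumption)
  have h3 : p < (1 + 1) * (r ^ k / (1 - 1 * r ^ k) + r ^ m / (1 - 1 * r ^ m)) := by
    unfold Psi at hΨ
    rw [one_mul, one_mul]
    linarith
  obtain ⟨a, ha, ha01⟩ := ((h1.eventually_lt h2 h3).and
    (Ioo_mem_nhdsLT (show (0 : ℝ) < 1 by norm_num))).exists
  refine ⟨a, ha01, ?_⟩
  rw [slope_def_field, Real.one_rpow, ← neg_div_neg_eq, div_lt_iff₀ (by linarith [ha01.2])] at ha
  nlinarith [ha]

section Extremal

variable {X : Type*} [NormedAddCommGroup X] [NormedSpace ℂ X]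

/-- The disk automorphism `t ↦ (a - t) / (1 - a * t)` applied to a functional `ℓ`. -/
noncomputable def extremalFun (a : ℝ) (ℓ : X →L[ℂ] ℂ) (z : X) : ℂ := (a - ℓ z) / (1 - a * ℓ z)

/-- The homogeneous terms of `extremalFun a ℓ`, from
`(a - t) / (1 - a * t) = a - (1 - a ^ 2) * ∑ j, a ^ j * t ^ (j + 1)`. -/
noncomputable def extremalTerm (a : ℝ) (ℓ : X →L[ℂ] ℂ) : ℕ → X → ℂ
  | 0, _ => a
  | j + 1, z => -(1 - a ^ 2) * a ^ j * ℓ z ^ (j + 1)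

lemma isHomogeneousPolynomial_const_mul_pow (c : ℂ) (ℓ : X →L[ℂ] ℂ) (n : ℕ) :
    IsHomogeneousPolynomial n (fun z => c * ℓ z ^ n) :=
  ⟨c • (MultilinearMap.mkPiAlgebraFin ℂ n ℂ).compLinearMap fun _ => (ℓ : X →ₗ[ℂ] ℂ), fun x => by
    simp⟩

lemma norm_apply_lt_one {ℓ : X →L[ℂ] ℂ} (hℓ : ‖ℓ‖ ≤ 1) {z : X} (hz : z ∈ ball (0 : X) 1) :
    ‖ℓ z‖ < 1 :=
  (ℓ.le_of_opNorm_le hℓ z).trans_lt (by simpa using hz)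

lemma norm_ofReal_mul_lt_one {a : ℝ} (ha0 : 0 < a) (ha1 : a < 1) {t : ℂ} (ht : ‖t‖ < 1) :
    ‖a * t‖ < 1 := by
  rw [norm_mul, Complex.norm_real, Real.norm_of_nonneg ha0.le]
  nlinarith [norm_nonneg t]

lemma one_sub_mul_ne_zero {a : ℝ} (ha0 : 0 < a) (ha1 : a < 1) {t : ℂ} (ht : ‖t‖ < 1) :
    1 - a * t ≠ 0 := by
  intro h
  have := norm_ofReal_mul_lt_one ha0 ha1 ht
  rw [← sub_eq_zero.1 h] at this
  simp at this

lemma norm_blaschke_lt_one {a : ℝ} (ha0 : 0 < a) (ha1 : a < 1) {t : ℂ} (ht : ‖t‖ < 1) :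
    ‖(a - t) / (1 - a * t)‖ < 1 := by
  rw [norm_div, div_lt_one (norm_pos_iff.2 (one_sub_mul_ne_zero ha0 ha1 ht))]
  refine lt_of_pow_lt_pow_left₀ 2 (norm_nonneg _) ?_
  have ht2 : ‖t‖ ^ 2 < 1 := by nlinarith [norm_nonneg t]
  rw [← Complex.normSq_eq_norm_sq, Complex.normSq_apply] at ht2 ⊢
  rw [← Complex.normSq_eq_norm_sq, Complex.normSq_apply]
  simp only [sub_re, sub_im, mul_re, mul_im, ofReal_re, ofReal_im, one_re, one_im]
  nlinarith [mul_pos (show 0 < 1 - a ^ 2 by nlinarith) (sub_pos.2 ht2)]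

lemma isHolWithExpansion_extremal {a : ℝ} (ha0 : 0 < a) (ha1 : a < 1) {ℓ : X →L[ℂ] ℂ}
    (hℓ : ‖ℓ‖ ≤ 1) : IsHolWithExpansion (extremalFun a ℓ) (extremalTerm a ℓ) where
  holo := by
    intro z hz
    have := one_sub_mul_ne_zero ha0 ha1 (norm_apply_lt_one hℓ hz)
    unfold extremalFun
    exact DifferentiableAt.differentiableWithinAt (by fun_prop (disch := assumption))
  mapsTo z hz := by
    rw [mem_ball_zero_iff]
    exact norm_blaschke_lt_one ha0 ha1 (norm_apply_lt_one hℓ hz)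
  homogeneous j := by
    cases j with
    | zero =>
      have := isHomogeneousPolynomial_const_mul_pow (a : ℂ) ℓ 0
      simp only [pow_zero, mul_one] at this
      exact this
    | succ j => exact isHomogeneousPolynomial_const_mul_pow _ ℓ (j + 1)
  hasSum z hz := by
    have ht := norm_apply_lt_one hℓ hz
    have hne := one_sub_mul_ne_zero ha0 ha1 ht
    have hs := (hasSum_geometric_of_norm_lt_one (norm_ofReal_mul_lt_one ha0 ha1 ht)).mul_left
      (-(1 - (a : ℂ) ^ 2) * ℓ z)
    rw [← hasSum_nat_add_iff' 1]
    have e1 : (fun j => extremalTerm a ℓ (j + 1) z)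
        = fun j => -(1 - (a : ℂ) ^ 2) * ℓ z * (a * ℓ z) ^ j := by
      ext j; simp only [extremalTerm]; ring
    have e2 : extremalFun a ℓ z - ∑ i ∈ Finset.range 1, extremalTerm a ℓ i z
        = -(1 - (a : ℂ) ^ 2) * ℓ z * (1 - a * ℓ z)⁻¹ := by
      rw [Finset.sum_range_one]
      simp only [extremalFun, extremalTerm]
      field_simp
      ring
    rw [e1, e2]
    exact hs

lemma isSchwarzMapping_pow_smul {n : ℕ} (hn : 1 ≤ n) {ℓ : X →L[ℂ] ℂ} (hℓ : ‖ℓ‖ ≤ 1) {u : X}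
    (hu : ‖u‖ = 1) (hℓu : ℓ u = 1) : IsSchwarzMapping n (fun z => ℓ z ^ n • u) := by
  have hD : ∀ j v, dirDeriv j (fun z => ℓ z ^ n • u) v
      = ((if j = n then (n.factorial : ℂ) else 0) * ℓ v ^ n) • u := by
    intro j v
    have e : (fun h : ℂ => ℓ (h • v) ^ n • u) = fun h : ℂ => h ^ n • (ℓ v ^ n • u) := by
      ext h
      rw [map_smul, smul_eq_mul, mul_pow, mul_smul]
    unfold dirDeriv
    rw [e, iteratedDeriv_smul_const (by fun_prop), iteratedDeriv_fun_pow_zero, smul_smul]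
    push_cast
    rfl
  refine ⟨by fun_prop, fun z hz => ?_, by simp [show n ≠ 0 by omega], fun j hj v => ?_, u, ?_⟩
  · rw [mem_ball_zero_iff, norm_smul, hu, mul_one, norm_pow]
    exact pow_lt_one₀ (norm_nonneg _) (norm_apply_lt_one hℓ hz) (by omega)
  · rw [hD, if_neg hj.ne, zero_mul, zero_smul]
  · rw [hD, if_pos rfl, hℓu, one_pow, mul_one]
    exact smul_ne_zero (by exact_mod_cast n.factorial_ne_zero) (norm_ne_zero_iff.1 (by simp [hu]))

/-- The refined Bohr sum of the extremal function at `r • u`, with the sum of squares dropped. -/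
lemma le_bohrSum_extremal {k m : ℕ} (hk : 1 ≤ k) (hm : 1 ≤ m) {a p r : ℝ} (ha0 : 0 < a)
    (ha1 : a < 1) (hr0 : 0 ≤ r) (hr1 : r < 1) {ℓ : X →L[ℂ] ℂ} {u : X} (hu : ‖u‖ = 1)
    (hℓu : ℓ u = 1) :
    a ^ p + (1 - a ^ 2) * (r ^ k / (1 - a * r ^ k) + r ^ m / (1 - a * r ^ m))
      ≤ bohrSum k p (extremalFun a ℓ) (extremalTerm a ℓ) (fun z => ℓ z ^ k • u)
        (fun z => ℓ z ^ m • u) ((r : ℂ) • u) := by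
  have hK : r ^ k < 1 := pow_lt_one₀ hr0 hr1 (by omega)
  have hM : r ^ m < 1 := pow_lt_one₀ hr0 hr1 (by omega)
  have hK0 : 0 ≤ r ^ k := by positivity
  have hM0 : 0 ≤ r ^ m := by positivity
  have ha2 : 0 ≤ 1 - a ^ 2 := by nlinarith
  have hf0 : extremalFun a ℓ 0 = a := by simp [extremalFun]
  have hn0 : ‖extremalFun a ℓ 0‖ = a := by simp [hf0, abs_of_pos ha0]
  have hz : ‖(r : ℂ) • u‖ = r := by simp [norm_smul, hu, abs_of_nonneg hr0]
  have hℓz : ∀ n : ℕ, ℓ (ℓ ((r : ℂ) • u) ^ n • u) = (r ^ n : ℝ) := by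
    intro n; simp [hℓu]
  have hterm : ∀ j : ℕ, ‖extremalTerm a ℓ (j + 1) (ℓ ((r : ℂ) • u) ^ k • u)‖
      = ((1 - a ^ 2) * r ^ k) * (a * r ^ k) ^ j := by
    intro j
    simp only [extremalTerm]
    rw [hℓz]
    have : (-(1 - (a : ℂ) ^ 2) * a ^ j * ((r ^ k : ℝ) : ℂ) ^ (j + 1))
      = ((-(((1 - a ^ 2) * r ^ k) * (a * r ^ k) ^ j) : ℝ) : ℂ) := by push_cast; ring
    rw [this, Complex.norm_real, norm_neg, Real.norm_of_nonneg (by positivity)]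
  have hak : a * r ^ k < 1 := by nlinarith
  have ham : a * r ^ m < 1 := by nlinarith
  have hsum : ∑' j : ℕ, ‖extremalTerm a ℓ (j + 1) (ℓ ((r : ℂ) • u) ^ k • u)‖
      = (1 - a ^ 2) * (r ^ k / (1 - a * r ^ k)) := by
    simp_rw [hterm]
    rw [tsum_mul_left, tsum_geometric_of_lt_one (by positivity) hak]
    ring
  have hdiff : ‖extremalFun a ℓ (ℓ ((r : ℂ) • u) ^ m • u) - extremalFun a ℓ 0‖
      = (1 - a ^ 2) * (r ^ m / (1 - a * r ^ m)) := by
    rw [hf0]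
    unfold extremalFun
    rw [hℓz]
    have hne : 1 - a * r ^ m ≠ 0 := by linarith
    have : ((a : ℂ) - (r ^ m : ℝ)) / (1 - a * (r ^ m : ℝ)) - a
        = ((-((1 - a ^ 2) * (r ^ m / (1 - a * r ^ m))) : ℝ) : ℂ) := by
      have hne' : (1 - a * (r ^ m : ℝ) : ℂ) ≠ 0 := by exact_mod_cast hne
      push_cast at hne' ⊢
      field_simp
      ring
    rw [this, Complex.norm_real, norm_neg, Real.norm_of_nonneg]
    exact mul_nonneg ha2 (div_nonneg hM0 (by linarith))
  unfold bohrSum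
  rw [hn0, hz, hsum, hdiff]
  have : 0 ≤ (1 / (1 + a) + r ^ k / (1 - r ^ k))
      * ∑' j : ℕ, ‖extremalTerm a ℓ (j + 1) (ℓ ((r : ℂ) • u) ^ k • u)‖ ^ 2 :=
    mul_nonneg (add_nonneg (by positivity) (div_nonneg hK0 (by linarith)))
      (tsum_nonneg fun _ => sq_nonneg _)
  linarith

end Extremal

end

end BohrBanach

theorem theorem7 {X : Type*} [NormedAddCommGroup X] [NormedSpace ℂ X] [CompleteSpace X]
    (k m : ℕ) (hk : 1 ≤ k) (hm : 1 ≤ m) (p : ℝ) (hp0 : 0 < p) (hp2 : p ≤ 2) :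
    ∃ R : ℝ,
      -- `R` is the unique root of `Ψ₁` in `(0, 1)`
      (R ∈ Set.Ioo (0 : ℝ) 1 ∧ BohrBanach.Psi k m p R = 0 ∧
        ∀ s ∈ Set.Ioo (0 : ℝ) 1, BohrBanach.Psi k m p s = 0 → s = R) ∧
      -- the inequality holds for `‖z‖ ≤ R`, and both series converge
      (∀ (f : X → ℂ) (P : ℕ → X → ℂ) (μk μm : X → X),
        BohrBanach.IsHolWithExpansion f P →
        BohrBanach.IsSchwarzMapping k μk → BohrBanach.IsSchwarzMapping m μm →
        ∀ z : X, ‖z‖ ≤ R →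
          Summable (fun j : ℕ => ‖P (j + 1) (μk z)‖) ∧
          Summable (fun j : ℕ => ‖P (j + 1) (μk z)‖ ^ 2) ∧
          BohrBanach.bohrSum k p f P μk μm z ≤ 1) ∧
      -- `R` is best possible
      (Nontrivial X → ∀ r : ℝ, R < r → r < 1 →
        ∃ (f : X → ℂ) (P : ℕ → X → ℂ) (μk μm : X → X) (z : X),
          BohrBanach.IsHolWithExpansion f P ∧
          BohrBanach.IsSchwarzMapping k μk ∧ BohrBanach.IsSchwarzMapping m μm ∧
          ‖z‖ = r ∧
          Summable (fun j : ℕ => ‖P (j + 1) (μk z)‖) ∧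
          Summable (fun j : ℕ => ‖P (j + 1) (μk z)‖ ^ 2) ∧
          1 < BohrBanach.bohrSum k p f P μk μm z) := by
  obtain ⟨R, hR, hR0⟩ := BohrBanach.exists_Psi_eq_zero hk hm hp0 hp2
  have hmono := BohrBanach.Psi_strictMonoOn hk hm p
  have hRmem : R ∈ Set.Ico (0 : ℝ) 1 := ⟨hR.1.le, hR.2⟩
  refine ⟨R, ⟨hR, hR0, fun s hs hs0 => hmono.injOn ⟨hs.1.le, hs.2⟩ hRmem (hs0.trans hR0.symm)⟩,
    fun f P μk μm hf hμk hμm z hz => ?_, fun hX r hRr hr1 => ?_⟩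
  · have hz1 : ‖z‖ < 1 := hz.trans_lt hR.2
    refine BohrBanach.bohrSum_le_one hk hm hp0 hp2 hf hμk hμm hz1 ?_
    exact hR0 ▸ hmono.monotoneOn ⟨norm_nonneg z, hz1⟩ hRmem hz
  · have hr0 : 0 ≤ r := hR.1.le.trans hRr.le
    obtain ⟨a, ⟨ha0, ha1⟩, ha⟩ :=
      BohrBanach.exists_lt_of_Psi_pos hk hm hr0 hr1 (hR0 ▸ hmono hRmem ⟨hr0, hr1⟩ hRr)
    obtain ⟨u, hu⟩ := exists_norm_eq X (zero_le_one' ℝ)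
    obtain ⟨ℓ, hℓ, hℓu⟩ := exists_dual_vector'' ℂ u
    replace hℓu : ℓ u = 1 := by simpa [hu] using hℓu
    have hz : ‖(r : ℂ) • u‖ = r := by simp [norm_smul, hu, abs_of_nonneg hr0]
    have hf := BohrBanach.isHolWithExpansion_extremal ha0 ha1 hℓ
    have hμk := BohrBanach.isSchwarzMapping_pow_smul hk hℓ hu hℓu
    have hμm := BohrBanach.isSchwarzMapping_pow_smul hm hℓ hu hℓu
    obtain ⟨s1, s2, -⟩ := hf.refined_bohr
      (hμk.norm_le_pow hk (z := (r : ℂ) • u) (by rw [hz]; exact hr1))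
      (by rw [hz]; exact pow_lt_one₀ hr0 hr1 (by omega))
    exact ⟨_, _, _, _, (r : ℂ) • u, hf, hμk, hμm, hz, s1, s2,
      ha.trans_le (BohrBanach.le_bohrSum_extremal hk hm ha0 ha1 hr0 hr1 hu hℓu)⟩
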